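/- Let $k$ and $n$ be positive even integers and put $\lambda=k-n/2$. Let $h(z)=\sum_{m\ge1}c_h(m)e^{2\pi i m z}$ be a cuspidal Hecke eigenform in the Kohnen plus space $\mathfrak S^+_{\lambda+1/2}(\Gamma_0(4))$, i.e. a nonzero cusp form of weight $\lambda+1/2$ for $\Gamma_0(4)$ such that $c_h(m)=0$ unless $(-1)^{\lambda}m\equiv 0,1 \pmod 4$ (here $(-1)^\lambda=(-1)^{n/2}$), which is an eigenform of the Hecke operators $T(p^2)$ for all primes $p$, where $$T(p^2)\Big(\sum_m c(m)q^m\Big)=\sum_{(-1)^\lambda m\equiv 0,1\,(4)}\Big(c(p^2m)+\Big(\tfrac{(-1)^\lambda m}{p}\Big)p^{\lambda-1}c(m)+p^{2\lambda-1}c(m/p^2)\Big)q^m .$$ Let $f(z)=\sum_{m\ge1}c_f(m)e^{2\pi i m z}$ be the primitive form (normalized Hecke eigenform) of weight $2k-n$ for $SL_2(\mathbf Z)$ corresponding to $h$ under the Shimura correspondence, i.e. for every prime $p$ the eigenvalue of $T(p)$ on $f$ is the eigenvalue of $T(p^2)$ on $h$. Put $L(s,h)=\sum_{m\ge1}c_h(m)m^{-s}$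 and $L(s,f)=\sum_{m\ge1}c_f(m)m^{-s}$, and for a fundamental discriminant $d_0$ (that is, $d_0=1$ or $d_0$ is the discriminant of a quadratic field) let $L(s,(\tfrac{d_0}{*}))$ be the Dirichlet $L$-series of the Kronecker symbol $(\tfrac{d_0}{*})$. Then for every complex $s$ with $\mathrm{Re}(s)>\tfrac12\left(k-\tfrac n2\right)+\tfrac34$, $$L(s,h)=L(2s,f)\sum_{d_0}c_h(|d_0|)\,|d_0|^{-s}\,L\Big(2s-k+\tfrac n2+1,\Big(\frac{d_0}{*}\Big)\Big)^{-1},$$ where $d_0$ runs over all fundamental discriminants with $(-1)^{n/2}d_0>0$; the series $L(s,h)$, $L(2s,f)$, $L(2s-k+\frac n2+1,(\frac{d_0}{*}))$ and the sum over $d_0$ all converge absolutely, and the values $L(2s-k+\frac n2+1,(\frac{d_0}{*}))$ are nonzero. -/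

import Mathlib

open scoped UpperHalfPlane MatrixGroups CongruenceSubgroup Manifold

noncomputable section

/-! ### Fundamental discriminants and Kronecker symbols -/

/-- `D` is a fundamental discriminant: `D = 1` or `D` is the discriminant of a quadratic field.
Explicitly, `D` is squarefree and `D ≡ 1 mod 4`, or `D = 4 m` with `m` squarefree and
`m ≡ 2, 3 mod 4`. -/
def IsFundamentalDiscriminant (D : ℤ) : Prop :=
  (D % 4 = 1 ∧ Squarefree D) ∨
    ∃ m : ℤ, D = 4 * m ∧ (m % 4 = 2 ∨ m % 4 = 3) ∧ Squarefree m

/-- The Kronecker symbol `(a / p)` at a prime `p`. For odd `p` it is the Legendre symbol; for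
`p = 2` it is `0` if `a` is even, `1` if `a ≡ ±1 mod 8` and `-1` if `a ≡ ±3 mod 8`. -/
def kroneckerPrime (a : ℤ) (p : ℕ) : ℤ :=
  if p = 2 then ZMod.χ₈ (a : ZMod 8) else jacobiSym a p

/-- The Kronecker symbol `(a / m)` for natural numbers `m`, completely multiplicative in `m ≠ 0`,
with `(a / 0) = 1` if `a = ± 1` and `(a / 0) = 0` otherwise. If `a` is a fundamental
discriminant, this is the quadratic Dirichlet character attached to `ℚ(√a) / ℚ` (and the constant
`1` if `a = 1`). -/
def kroneckerSymbol (a : ℤ) (m : ℕ) : ℤ :=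
  if m = 0 then (if a.natAbs = 1 then 1 else 0)
  else (m.primeFactorsList.map (kroneckerPrime a)).prod

/-- The Dirichlet `L`-series `L(s, (D / *))`. -/
def kroneckerL (D : ℤ) (s : ℂ) : ℂ :=
  LSeries (fun m ↦ (kroneckerSymbol D m : ℂ)) s

/-! ### Fourier coefficients -/

/-- The `m`-th Fourier coefficient `c(m)` of a `1`-periodic holomorphic function
`g(z) = ∑ c(m) exp(2 π i m z)` on the upper half plane. -/
def fourierCoeff₁ (g : ℍ → ℂ) (m : ℕ) : ℂ :=
  (UpperHalfPlane.qExpansion 1 g).coeff m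

/-! ### Cusp forms of half-integral weight for `Γ₀(4)` and the Kohnen plus space -/

/-- The theta series `θ(z) = ∑_{m ∈ ℤ} exp(2 π i m² z)`. -/
def thetaSeries (z : ℍ) : ℂ := jacobiTheta (2 * (z : ℂ))

/-- The factor of automorphy `j(γ, z) = θ(γ z) / θ(z)` of weight `1/2`, for `γ ∈ Γ₀(4)`. -/
def thetaFactor (γ : SL(2, ℤ)) (z : ℍ) : ℂ := thetaSeries (γ • z) / thetaSeries z

/-- `h` is a cusp form of weight `l + 1/2` for `Γ₀(4)`: it is holomorphic, satisfies
`h(γ z) = j(γ, z)^(2 l + 1) h(z)` for `γ ∈ Γ₀(4)`, and vanishes at every cusp, i.e. for every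
`γ ∈ SL₂(ℤ)` the function `(c z + d)^(- l - 1/2) h(γ z)` (which is determined up to a constant of
absolute value one) tends to `0` as `Im z → ∞`. -/
structure IsHalfIntegralCuspForm (l : ℤ) (h : ℍ → ℂ) : Prop where
  holo : MDiff h
  transform : ∀ γ ∈ CongruenceSubgroup.Gamma0 4, ∀ z : ℍ,
    h (γ • z) = thetaFactor γ z ^ (2 * l + 1) * h z
  zero_at_cusps : ∀ γ : SL(2, ℤ), UpperHalfPlane.IsZeroAtImInfty fun z : ℍ ↦
    UpperHalfPlane.denom γ z ^ (-(l : ℂ) - 1 / 2) * h (γ • z)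

/-- The condition `(-1)^l m ≡ 0, 1 mod 4` on the index of a Fourier coefficient. -/
def IsPlusIndex (l : ℤ) (m : ℕ) : Prop :=
  ((l.negOnePow : ℤ) * (m : ℤ)) % 4 = 0 ∨ ((l.negOnePow : ℤ) * (m : ℤ)) % 4 = 1

/-- `h` lies in the Kohnen plus space of cusp forms of weight `l + 1/2` for `Γ₀(4)`: the `m`-th
Fourier coefficient vanishes unless `(-1)^l m ≡ 0, 1 mod 4`. -/
structure IsKohnenPlusCuspForm (l : ℤ) (h : ℍ → ℂ) : Prop
    extends IsHalfIntegralCuspForm l h where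
  plus : ∀ m : ℕ, ¬ IsPlusIndex l m → fourierCoeff₁ h m = 0

open scoped Classical in
/-- The Hecke operator `T(p²)` (for any prime `p`, including `p = 2`) on the Kohnen plus space of
weight `l + 1/2`, in terms of Fourier coefficients: it sends `∑ c(m) q^m` to
`∑ (c(p² m) + ((-1)^l m / p) p^(l-1) c(m) + p^(2l-1) c(m / p²)) q^m`, where both sums run over
`m` with `(-1)^l m ≡ 0, 1 mod 4`, and `c(m / p²) = 0` if `p² ∤ m`. -/
def kohnenHecke (l : ℤ) (p : ℕ) (c : ℕ → ℂ) (m : ℕ) : ℂ :=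
  if IsPlusIndex l m then
    c (p ^ 2 * m)
      + (kroneckerPrime ((l.negOnePow : ℤ) * (m : ℤ)) p : ℂ) * (p : ℂ) ^ (l - 1) * c m
      + (if p ^ 2 ∣ m then (p : ℂ) ^ (2 * l - 1) * c (m / p ^ 2) else 0)
  else 0

/-- `T(p²) h = μ h` for the form `h` in the Kohnen plus space of weight `l + 1/2`. -/
def KohnenHeckeEigen (l : ℤ) (h : ℍ → ℂ) (p : ℕ) (μ : ℂ) : Prop :=
  ∀ m : ℕ, kohnenHecke l p (fourierCoeff₁ h) m = μ * fourierCoeff₁ h m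

/-- `h` is a cuspidal Hecke eigenform in the Kohnen plus space of weight `l + 1/2` for `Γ₀(4)`. -/
structure IsKohnenPlusEigenform (l : ℤ) (h : ℍ → ℂ) : Prop
    extends IsKohnenPlusCuspForm l h where
  ne_zero : h ≠ 0
  eigen : ∀ p : ℕ, p.Prime → ∃ μ : ℂ, KohnenHeckeEigen l h p μ

/-! ### Primitive forms of level one and the Shimura correspondence -/

/-- The Hecke operator `T(p)` in weight `w` and level one:
`(T(p) f)(z) = p^(w-1) f(p z) + p^(-1) ∑_{0 ≤ b < p} f((z + b) / p)`. -/
def heckeOperator (w : ℤ) (p : ℕ) (f : ℍ → ℂ) (z : ℍ) : ℂ :=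
  (p : ℂ) ^ (w - 1) * f (UpperHalfPlane.ofComplex ((p : ℂ) * z))
    + (p : ℂ)⁻¹ * ∑ b ∈ Finset.range p, f (UpperHalfPlane.ofComplex (((z : ℂ) + b) / p))

/-- `T(p) f = μ f`. -/
def HeckeEigen (w : ℤ) (f : ℍ → ℂ) (p : ℕ) (μ : ℂ) : Prop :=
  ∀ z : ℍ, heckeOperator w p f z = μ * f z

/-- A primitive form for `SL₂(ℤ)`: a cusp form which is an eigenform of all Hecke operators, and
whose first Fourier coefficient is `1`. -/
structure IsPrimitiveForm {w : ℤ} (f : CuspForm 𝒮ℒ w) : Prop where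
  normalized : fourierCoeff₁ f 1 = 1
  eigen : ∀ p : ℕ, p.Prime → ∃ μ : ℂ, HeckeEigen w f p μ

/-- `f`, of weight `2 l`, corresponds to `h`, of weight `l + 1/2`, under the Shimura
correspondence: for every prime `p`, the eigenvalue of `T(p²)` on `h` equals the eigenvalue of
`T(p)` on `f`. -/
def IsShimuraLift (l : ℤ) (h : ℍ → ℂ) (f : ℍ → ℂ) : Prop :=
  ∀ p : ℕ, p.Prime → ∃ μ : ℂ, KohnenHeckeEigen l h p μ ∧ HeckeEigen (2 * l) f p μ

end

/-! Write l = k - n/2. Every m ≥ 1 with (-1)^l m ≡ 0, 1 mod 4 is uniquely |d| r² with d a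
fundamental discriminant of sign (-1)^l, so L(s,h) is the sum over d of |d|^(-s) ∑_r c_h(|d| r²)
r^(-2s).

For fixed d, the eigenvalue equations of h give a recursion for r ↦ c_h(|d| r²) that differs from
the one for c_f only by a term in χ_d(p) p^(l-1). Convolving with χ_d(r) r^(l-1) removes that term
(`convolution_hecke_recursion`), so the convolution is c_h(|d|) c_f. In terms of series, L(2s-l+1,
χ_d) ∑_r c_h(|d| r²) r^(-2s) = c_h(|d|) L(2s,f), and it remains to divide and sum over d
(`IsShimuraLift.lseries_eq`).

Rearranging requires absolute convergence of L(s,h) for Re s > l/2 + 3/4. Since h⁴ is a cusp form of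
integral weight 4l+2, |h|² ≪ y^(-l-1/2); Bessel and Cauchy–Schwarz then give ∑_{m≤N} |c_h(m)| ≪
N^(l/2+3/4). In this range Re(2s-l+1) > 5/2, where the Dirichlet L-values are bounded away from 0
uniformly in d. -/

noncomputable section

open scoped ModularForm

/-! ### Generators of Γ₀(4) and the automorphy of θ⁴. -/

open Matrix.SpecialLinearGroup in
/-- `Γ₀(4)` is generated by `T`, `-1` and the matrix with rows `(1, 0)` and `(4, 1)`. -/
theorem Gamma0_four_le {H : Subgroup SL(2, ℤ)} (hT : ModularGroup.T ∈ H) (hneg : -1 ∈ H)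
    {V : SL(2, ℤ)} (hV : V ∈ H) (hVc : (V : Matrix (Fin 2) (Fin 2) ℤ) = !![1, 0; 4, 1]) :
    CongruenceSubgroup.Gamma0 4 ≤ H := by
  suffices ∀ N : ℕ, ∀ γ : SL(2, ℤ), (4 : ℤ) ∣ γ 1 0 → (γ 1 0).natAbs + (γ 1 1).natAbs ≤ N →
      γ ∈ H by
    intro γ hγ
    rw [CongruenceSubgroup.Gamma0_mem] at hγ
    exact this _ γ ((ZMod.intCast_zmod_eq_zero_iff_dvd _ 4).mp hγ) le_rfl
  have hVinv : ((V⁻¹ : SL(2, ℤ)) : Matrix (Fin 2) (Fin 2) ℤ) = !![1, 0; -4, 1] := by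
    simp [coe_inv, hVc, Matrix.adjugate_fin_two]
  intro N
  induction N with
  | zero =>
    intro γ _ h0
    have hd := γ.det_coe
    rw [Matrix.det_fin_two] at hd
    have h1 : γ 1 0 = 0 := by omega
    have h2 : γ 1 1 = 0 := by omega
    simp [h1, h2] at hd
  | succ N ih =>
    intro γ h4 hN
    have hd := γ.det_coe
    rw [Matrix.det_fin_two] at hd
    have key (δ : SL(2, ℤ)) (hδ : δ ∈ H) (h4' : (4 : ℤ) ∣ (γ * δ) 1 0)
        (hlt : ((γ * δ) 1 0).natAbs + ((γ * δ) 1 1).natAbs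
          < (γ 1 0).natAbs + (γ 1 1).natAbs) : γ ∈ H :=
      (Subgroup.mul_mem_cancel_right H hδ).mp (ih (γ * δ) h4' (by omega))
    have hT10 : (γ * ModularGroup.T) 1 0 = γ 1 0 := by
      simp [coe_mul, Matrix.mul_apply, Fin.sum_univ_two, ModularGroup.coe_T]
    have hT11 : (γ * ModularGroup.T) 1 1 = γ 1 0 + γ 1 1 := by
      simp [coe_mul, Matrix.mul_apply, Fin.sum_univ_two, ModularGroup.coe_T]
    have hTi10 : (γ * ModularGroup.T⁻¹) 1 0 = γ 1 0 := by
      simp [coe_mul, Matrix.mul_apply, Fin.sum_univ_two, ModularGroup.coe_T, coe_inv,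
        Matrix.adjugate_fin_two]
    have hTi11 : (γ * ModularGroup.T⁻¹) 1 1 = - γ 1 0 + γ 1 1 := by
      simp [coe_mul, Matrix.mul_apply, Fin.sum_univ_two, ModularGroup.coe_T, coe_inv,
        Matrix.adjugate_fin_two]
    have hV10 : (γ * V) 1 0 = γ 1 0 + γ 1 1 * 4 := by
      simp [coe_mul, Matrix.mul_apply, Fin.sum_univ_two, hVc]
    have hV11 : (γ * V) 1 1 = γ 1 1 := by
      simp [coe_mul, Matrix.mul_apply, Fin.sum_univ_two, hVc]
    have hVi10 : (γ * V⁻¹) 1 0 = γ 1 0 - γ 1 1 * 4 := by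
      rw [coe_mul, Matrix.mul_apply, Fin.sum_univ_two, hVinv]; simp; ring
    have hVi11 : (γ * V⁻¹) 1 1 = γ 1 1 := by
      rw [coe_mul, Matrix.mul_apply, Fin.sum_univ_two, hVinv]; simp
    have hodd : γ 1 1 % 2 = 1 := by
      obtain ⟨t, ht⟩ := h4
      by_contra hne
      obtain ⟨u, hu⟩ : (2 : ℤ) ∣ γ 1 1 := by omega
      rw [ht, hu] at hd
      have : (2 : ℤ) ∣ 1 := ⟨γ 0 0 * u - 2 * (γ 0 1 * t), by linarith⟩
      omega
    rcases eq_or_ne (γ 1 0) 0 with h0 | h0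
    · rw [h0, mul_zero, sub_zero] at hd
      rcases Int.eq_one_or_neg_one_of_mul_eq_one' hd with ⟨ha, hb⟩ | ⟨ha, hb⟩
      · have : γ = ModularGroup.T ^ (γ 0 1) := by
          ext i j
          rw [ModularGroup.coe_T_zpow]
          fin_cases i <;> fin_cases j <;> simp [ha, hb, h0]
        rw [this]
        exact H.zpow_mem hT _
      · have : γ = -1 * ModularGroup.T ^ (-γ 0 1) := by
          ext i j
          rw [neg_one_mul, coe_neg, ModularGroup.coe_T_zpow]
          fin_cases i <;> fin_cases j <;> simp [ha, hb, h0]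
        rw [this]
        exact H.mul_mem hneg (H.zpow_mem hT _)
    -- Euclid on the bottom row (c, d): if |c| < 2|d|, one of d ± c is shorter than d; otherwise one
    -- of c ± 4d is shorter than c. The borderline |c| = 2|d| cannot occur, as 4 ∣ c and d is odd.
    · by_cases hcd : (γ 1 0).natAbs < 2 * (γ 1 1).natAbs
      · by_cases hs : ((γ 1 0) + (γ 1 1)).natAbs < (γ 1 1).natAbs
        · exact key _ hT (by rwa [hT10]) (by rw [hT10, hT11]; omega)
        · exact key _ (H.inv_mem hT) (by rwa [hTi10]) (by rw [hTi10, hTi11]; omega)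
      · by_cases hs : (γ 1 0 + γ 1 1 * 4).natAbs < (γ 1 0).natAbs
        · exact key _ hV (by rw [hV10]; omega) (by rw [hV10, hV11]; omega)
        · exact key _ (H.inv_mem hV) (by rw [hVi10]; omega) (by rw [hVi10, hVi11]; omega)

/-- The stabilizer of a function under the weight `k` slash action. -/
def slashStabilizer (k : ℤ) (f : ℍ → ℂ) : Subgroup SL(2, ℤ) where
  carrier := {γ | f ∣[k] γ = f}
  one_mem' := SlashAction.slash_one k f
  mul_mem' {a b} ha hb := by
    simp only [Set.mem_ofPred_eq] at *
    rw [SlashAction.slash_mul, ha, hb]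
  inv_mem' {a} ha := by
    simp only [Set.mem_ofPred_eq] at *
    nth_rw 1 [← ha]
    rw [← SlashAction.slash_mul, mul_inv_cancel, SlashAction.slash_one]

/-- The fourth power removes the branch of the square root: the factor (-iτ)^(1/2) becomes (-iτ)² =
-τ². -/
theorem jacobiTheta_pow_four_neg_inv {τ : ℂ} (hτ : 0 < τ.im) :
    jacobiTheta (-1 / τ) ^ 4 = -τ ^ 2 * jacobiTheta τ ^ 4 := by
  have h := jacobiTheta_S_smul ⟨τ, hτ⟩
  rw [UpperHalfPlane.modular_S_smul] at h
  have e : (-τ)⁻¹ = -1 / τ := by rw [← one_div, div_neg, neg_div]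
  simp only [e] at h
  rw [h, mul_pow, ← Complex.cpow_nat_mul]
  norm_num
  rw [mul_pow]
  simp

theorem thetaSeries_vadd_one (z : ℍ) : thetaSeries ((1 : ℝ) +ᵥ z) = thetaSeries z := by
  rw [thetaSeries, thetaSeries, ← jacobiTheta_two_add (2 * (z : ℂ))]
  simp [mul_add]

theorem thetaSeries_pow_four_slash {γ : SL(2, ℤ)} (hγ : γ ∈ CongruenceSubgroup.Gamma0 4) :
    (fun z ↦ thetaSeries z ^ 4) ∣[(2 : ℤ)] γ = fun z ↦ thetaSeries z ^ 4 := by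
  let V : SL(2, ℤ) := ⟨!![1, 0; 4, 1], by simp⟩
  suffices CongruenceSubgroup.Gamma0 4 ≤ slashStabilizer 2 (fun z ↦ thetaSeries z ^ 4) from this hγ
  refine Gamma0_four_le (V := V) ?_ ?_ ?_ rfl
  · ext z
    rw [ModularForm.slash_action_eq'_iff]
    rw [UpperHalfPlane.modular_T_smul, thetaSeries_vadd_one]
    simp [ModularGroup.coe_T]
  · ext z
    rw [ModularForm.slash_action_eq'_iff]
    simp
  · ext z
    rw [ModularForm.slash_action_eq'_iff]
    have hz := z.im_pos
    have hz0 := UpperHalfPlane.ne_zero z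
    have h4 : (4 * (z : ℂ) + 1) ≠ 0 := by
      intro h
      have := congrArg Complex.im h
      simp at this
      exact hz.ne' this
    have hV : ((V • z : ℍ) : ℂ) = z / (4 * z + 1) := by
      rw [UpperHalfPlane.coe_specialLinearGroup_apply]
      simp [V]
    have h2z : 0 < (2 * (z : ℂ)).im := by simpa using hz
    -- `V = W T⁻¹ W⁻¹` for the Fricke involution `W`
    have h3 : 0 < (-2 - 1 / (2 * (z : ℂ))).im := by
      have := UpperHalfPlane.im_inv_neg_coe_pos ⟨2 * (z : ℂ), h2z⟩
      simpa [inv_neg, one_div] using this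
    have e1 : 2 * ((z : ℂ) / (4 * z + 1)) = -1 / (-2 - 1 / (2 * (z : ℂ))) := by
      have : (-2 - 1 / (2 * (z : ℂ))) = - (4 * z + 1) / (2 * z) := by field_simp; ring
      rw [this]; field_simp
    have e2 : jacobiTheta (-2 - 1 / (2 * (z : ℂ))) = jacobiTheta (-1 / (2 * z)) := by
      rw [← jacobiTheta_two_add]; congr 1; ring
    simp only [thetaSeries, hV]
    rw [e1, jacobiTheta_pow_four_neg_inv h3, e2, jacobiTheta_pow_four_neg_inv h2z]
    simp only [V, Matrix.cons_val', Matrix.cons_val_zero, Matrix.cons_val_one, Matrix.of_apply,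
      Matrix.cons_val_fin_one]
    push_cast
    norm_cast
    push_cast
    field_simp
    ring

theorem thetaSeries_pow_four_smul {γ : SL(2, ℤ)} (hγ : γ ∈ CongruenceSubgroup.Gamma0 4) (z : ℍ) :
    thetaSeries (γ • z) ^ 4 = UpperHalfPlane.denom γ z ^ (2 : ℤ) * thetaSeries z ^ 4 := by
  have := congrFun (thetaSeries_pow_four_slash hγ) z
  rwa [ModularForm.slash_action_eq'_iff] at this

/-! ### Growth of h through its fourth power. -/

namespace IsHalfIntegralCuspForm

variable {l : ℤ} {h : ℍ → ℂ}

/-- This replaces the nonvanishing of θ on ℍ. At a zero of θ the convention 0/0 = 0 makes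
`thetaFactor 1 z` vanish, and 2l+1 ≠ 0, so the transformation law at γ = 1 reads h z = 0. -/
theorem eq_zero_of_thetaSeries_eq_zero (hh : IsHalfIntegralCuspForm l h) {z : ℍ}
    (hz : thetaSeries z = 0) : h z = 0 := by
  have := hh.transform 1 (one_mem _) z
  rw [one_smul, thetaFactor, hz, div_zero, zero_zpow _ (by omega), zero_mul] at this
  exact this

theorem pow_four_smul (hh : IsHalfIntegralCuspForm l h) {γ : SL(2, ℤ)}
    (hγ : γ ∈ CongruenceSubgroup.Gamma0 4) (z : ℍ) :
    h (γ • z) ^ 4 = UpperHalfPlane.denom γ z ^ (4 * l + 2) * h z ^ 4 := by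
  rw [hh.transform γ hγ z, mul_pow]
  by_cases hz : thetaSeries z = 0
  · simp [hh.eq_zero_of_thetaSeries_eq_zero hz]
  · rw [← zpow_natCast (thetaFactor γ z ^ (2 * l + 1)), zpow_comm, zpow_natCast, thetaFactor,
      div_pow, thetaSeries_pow_four_smul hγ, mul_div_cancel_right₀ _ (pow_ne_zero _ hz), ← zpow_mul]
    congr 2
    ring

theorem apply_vadd_one (hh : IsHalfIntegralCuspForm l h) (z : ℍ) : h ((1 : ℝ) +ᵥ z) = h z := by
  have hT : ModularGroup.T ∈ CongruenceSubgroup.Gamma0 4 := by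
    simp [CongruenceSubgroup.Gamma0_mem, ModularGroup.coe_T]
  have := hh.transform _ hT z
  rw [UpperHalfPlane.modular_T_smul] at this
  rw [this]
  by_cases hz : thetaSeries z = 0
  · simp [hh.eq_zero_of_thetaSeries_eq_zero hz]
  · rw [thetaFactor, UpperHalfPlane.modular_T_smul, thetaSeries_vadd_one, div_self hz,
      one_zpow, one_mul]

theorem periodic (hh : IsHalfIntegralCuspForm l h) :
    Function.Periodic (h ∘ UpperHalfPlane.ofComplex) (1 : ℝ) := by
  intro w
  by_cases hw : 0 < w.im
  · have hw' : 0 < (w + (1 : ℝ)).im := by simpa using hw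
    simp only [Function.comp_apply, UpperHalfPlane.ofComplex_apply_of_im_pos hw',
      UpperHalfPlane.ofComplex_apply_of_im_pos hw]
    rw [← hh.apply_vadd_one ⟨w, hw⟩]
    congr 1
    ext
    simp [add_comm]
  · have hw' : (w + (1 : ℝ)).im ≤ 0 := by simpa using hw
    rw [Function.comp_apply, Function.comp_apply, UpperHalfPlane.ofComplex_apply_of_im_nonpos hw',
      UpperHalfPlane.ofComplex_apply_of_im_nonpos (not_lt.mp hw)]

theorem isZeroAtImInfty (hh : IsHalfIntegralCuspForm l h) : UpperHalfPlane.IsZeroAtImInfty h := by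
  simpa using hh.zero_at_cusps 1

/-- The fourth power of a cusp form of weight `l + 1/2` is a cusp form of weight `4 l + 2`. -/
def powFour (hh : IsHalfIntegralCuspForm l h) :
    CuspForm ((CongruenceSubgroup.Gamma0 4).map (Matrix.SpecialLinearGroup.mapGL ℝ))
      (4 * l + 2) where
  toFun z := h z ^ 4
  slash_action_eq' := by
    rintro _ ⟨γ, hγ, rfl⟩
    ext z
    have := (ModularForm.slash_action_eq'_iff (4 * l + 2) (fun z ↦ h z ^ 4) γ z).mpr
      (hh.pow_four_smul hγ z)
    exact this
  holo' := hh.holo.pow 4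
  zero_at_cusps' {c} hc := by
    rw [Subgroup.IsArithmetic.isCusp_iff_isCusp_SL2Z] at hc
    rw [OnePoint.isZeroAt_iff_forall_SL2Z hc]
    intro γ _
    have h1 := (hh.zero_at_cusps γ).pow 4
    rw [zero_pow (by norm_num)] at h1
    refine h1.congr fun z ↦ ?_
    rw [ModularForm.SL_slash_apply, mul_pow, ← Complex.cpow_nat_mul, mul_comm]
    congr 1
    rw [← Complex.cpow_intCast]
    congr 1
    push_cast
    ring

/-- Square root of Hecke's bound |h⁴| ≤ C y^(-(2l+1)) for the cusp form `powFour` of weight 4l+2. -/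
theorem exists_bound (hh : IsHalfIntegralCuspForm l h) :
    ∃ C, 0 ≤ C ∧ ∀ τ : ℍ, ‖h τ‖ ^ 2 ≤ C * τ.im ^ (-((l : ℝ) + 1 / 2)) := by
  obtain ⟨C, hC⟩ := CuspFormClass.exists_bound hh.powFour
  refine ⟨√C, Real.sqrt_nonneg _, fun τ ↦ ?_⟩
  have h1 : ‖h τ‖ ^ 4 ≤ C / τ.im ^ (((4 * l + 2 : ℤ) : ℝ) / 2) := by
    rw [← norm_pow]
    exact hC τ
  have hC0 : 0 ≤ C := by
    have : 0 < τ.im ^ (((4 * l + 2 : ℤ) : ℝ) / 2) := Real.rpow_pos_of_pos τ.im_pos _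
    have h2 := (le_div_iff₀ this).mp h1
    exact le_trans (by positivity) h2
  have := τ.im_pos
  refine le_of_sq_le_sq ?_ (by positivity)
  rw [mul_pow, Real.sq_sqrt hC0, ← pow_mul, ← Real.rpow_mul_natCast τ.im_pos.le]
  refine h1.trans (le_of_eq ?_)
  rw [div_eq_mul_inv, ← Real.rpow_neg τ.im_pos.le]
  congr 2
  push_cast
  ring

end IsHalfIntegralCuspForm

/-! ### Mean values of coefficients and absolute convergence. -/

open Filter MeasureTheory in
/-- Bessel's inequality on the horizontal line at height `y`. -/
theorem sum_norm_qExpansion_coeff_sq_le {h : ℍ → ℂ}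
    (hper : Function.Periodic (h ∘ UpperHalfPlane.ofComplex) (1 : ℝ)) (hhol : MDiff h)
    (hbdd : UpperHalfPlane.IsBoundedAtImInfty h) {y B : ℝ} (hy : 0 < y)
    (hB : ∀ τ : ℍ, τ.im = y → ‖h τ‖ ^ 2 ≤ B) (s : Finset ℕ) :
    ∑ m ∈ s, (‖fourierCoeff₁ h m‖ * Real.exp (-2 * Real.pi * m * y)) ^ 2 ≤ B := by
  let g : ℝ → ℂ := fun u ↦ h ⟨u + y * Complex.I, by simpa using hy⟩
  have hg : Continuous g := by
    refine hhol.continuous.comp ?_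
    exact UpperHalfPlane.isEmbedding_coe.continuous_iff.mpr
      (by simpa [Function.comp_def] using! by fun_prop)
  have hcoeff (m : ℕ) : ‖fourierCoeffOn zero_lt_one g (m : ℤ)‖
      = ‖fourierCoeff₁ h m‖ * Real.exp (-2 * Real.pi * m * y) := by
    have h1 : fourierCoeffOn zero_lt_one g (m : ℤ)
        = Complex.exp (-2 * Real.pi * m * y) * fourierCoeff₁ h m := by
      rw [fourierCoeff₁,
        UpperHalfPlane.qExpansion_coeff_eq_intervalIntegral one_pos hper hhol hbdd m hy,
        fourierCoeffOn_eq_integral]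
      simp only [Complex.ofReal_one, div_one, one_mul, one_smul, sub_zero,
        ← intervalIntegral.integral_const_mul]
      refine intervalIntegral.integral_congr fun u _ ↦ ?_
      simp only [g, smul_eq_mul, ← mul_assoc]
      congr 1
      rw [fourier_coe_apply, Function.Periodic.qParam, ← Complex.exp_nat_mul, one_div,
        ← Complex.exp_neg, ← Complex.exp_add]
      congr 1
      push_cast
      linear_combination (2 * Real.pi * m * y : ℂ) * Complex.I_sq
    rw [h1, norm_mul, mul_comm, Complex.norm_exp]
    simp
  have hL2 : MemLp g 2 (volume.restrict (Set.Ioc 0 1)) := by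
    refine MemLp.of_bound hg.aestronglyMeasurable (√B) (Eventually.of_forall fun x ↦ ?_)
    exact Real.le_sqrt_of_sq_le (hB _ (by simp [UpperHalfPlane.im]))
  have hP := hasSum_sq_fourierCoeffOn zero_lt_one hL2
  have hint : ((1 : ℝ) - 0)⁻¹ • ∫ x in (0 : ℝ)..1, ‖g x‖ ^ 2 ≤ B := by
    simp only [sub_zero, inv_one, one_smul]
    calc ∫ x in (0 : ℝ)..1, ‖g x‖ ^ 2 ≤ ∫ x in (0 : ℝ)..1, B := by
          refine intervalIntegral.integral_mono zero_le_one ?_ ?_ fun x ↦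
            hB _ (by simp [UpperHalfPlane.im])
          · exact (hg.norm.pow 2).intervalIntegrable _ _
          · exact continuous_const.intervalIntegrable _ _
      _ = B := by simp
  refine le_trans ?_ hint
  simp_rw [← hcoeff]
  have := sum_le_hasSum (s.map Nat.castEmbedding) (fun i _ ↦ by positivity) hP
  simpa using this

-- Bessel at height y = 1/n: for m ≤ n the damping exp(-2πm/n) is at least exp(-2π), so ∑_{m≤n}
-- |c(m)|² ≪ n^κ. Cauchy–Schwarz over n terms then yields the exponent (κ+1)/2.
open Filter Asymptotics in
theorem sum_norm_fourierCoeff_isBigO {h : ℍ → ℂ}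
    (hper : Function.Periodic (h ∘ UpperHalfPlane.ofComplex) (1 : ℝ)) (hhol : MDiff h)
    (hbdd : UpperHalfPlane.IsBoundedAtImInfty h) {C κ : ℝ}
    (hC : ∀ τ : ℍ, ‖h τ‖ ^ 2 ≤ C * τ.im ^ (-κ)) :
    (fun n : ℕ ↦ ∑ m ∈ Finset.Icc 1 n, ‖fourierCoeff₁ h m‖) =O[atTop]
      fun n ↦ (n : ℝ) ^ ((κ + 1) / 2) := by
  have hC0 : 0 ≤ C := by simpa using (sq_nonneg _).trans (hC UpperHalfPlane.I)
  refine IsBigO.of_bound (Real.exp (2 * Real.pi) * √C) ?_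
  filter_upwards [eventually_ge_atTop 1] with n hn
  have hn0 : (0 : ℝ) < n := by exact_mod_cast hn
  have h1 : ∑ m ∈ Finset.Icc 1 n, (‖fourierCoeff₁ h m‖) ^ 2
      ≤ (Real.exp (2 * Real.pi)) ^ 2 * (C * (n : ℝ) ^ κ) := by
    have := sum_norm_qExpansion_coeff_sq_le hper hhol hbdd (y := (n : ℝ)⁻¹)
      (B := C * (n : ℝ) ^ κ) (inv_pos.mpr hn0) (fun τ hτ ↦ (hC τ).trans_eq (by
        rw [hτ, Real.rpow_neg (by positivity), Real.inv_rpow hn0.le, inv_inv])) (Finset.Icc 1 n)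
    refine le_trans ?_ (mul_le_mul_of_nonneg_left this (by positivity))
    rw [Finset.mul_sum]
    refine Finset.sum_le_sum fun m hm ↦ ?_
    rw [← mul_pow]
    refine pow_le_pow_left₀ (norm_nonneg _) ?_ 2
    rw [mul_left_comm, ← Real.exp_add]
    refine le_mul_of_one_le_right (norm_nonneg _) (Real.one_le_exp ?_)
    have : (m : ℝ) * (n : ℝ)⁻¹ ≤ 1 := by
      rw [← div_eq_mul_inv, div_le_one hn0]
      exact_mod_cast (Finset.mem_Icc.mp hm).2
    nlinarith [Real.pi_pos]
  have h2 : (∑ m ∈ Finset.Icc 1 n, ‖fourierCoeff₁ h m‖) ^ 2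
      ≤ n * ((Real.exp (2 * Real.pi)) ^ 2 * (C * (n : ℝ) ^ κ)) := by
    refine (sq_sum_le_card_mul_sum_sq (s := Finset.Icc 1 n)).trans ?_
    simpa using mul_le_mul_of_nonneg_left h1 hn0.le
  rw [Real.norm_of_nonneg (by positivity), Real.norm_of_nonneg (by positivity)]
  refine le_of_sq_le_sq (h2.trans_eq ?_) (by positivity)
  rw [mul_pow, mul_pow, Real.sq_sqrt hC0, ← Real.rpow_mul_natCast hn0.le]
  rw [show (κ + 1) / 2 * ((2 : ℕ) : ℝ) = κ + 1 by push_cast; ring, Real.rpow_add_one hn0.ne']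
  ring

/-- The Dirichlet series of a cusp form of weight `l + 1/2` converges absolutely for
`Re s > l/2 + 3/4`. -/
theorem IsHalfIntegralCuspForm.lseriesSummable {l : ℤ} (hl : 0 ≤ l) {h : ℍ → ℂ}
    (hh : IsHalfIntegralCuspForm l h) {s : ℂ} (hs : (l : ℝ) / 2 + 3 / 4 < s.re) :
    LSeriesSummable (fourierCoeff₁ h) s := by
  obtain ⟨C, -, hC⟩ := hh.exists_bound
  have hl' : (0 : ℝ) ≤ l := by exact_mod_cast hl
  refine LSeriesSummable_of_sum_norm_bigO (r := ((l : ℝ) + 1 / 2 + 1) / 2)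
    (sum_norm_fourierCoeff_isBigO hh.periodic hh.holo hh.isZeroAtImInfty.isBoundedAtImInfty hC)
    (by positivity) (by linarith)

/-! ### Level one: convergence, weight and Hecke relations. -/

theorem CuspForm.lseriesSummable {w : ℤ} (f : CuspForm 𝒮ℒ w) {s : ℂ}
    (hs : (w : ℝ) / 2 + 1 < s.re) : LSeriesSummable (fourierCoeff₁ f) s := by
  refine LSeriesSummable_of_isBigO_rpow hs ?_
  have := CuspFormClass.qExpansion_isBigO f
  rw [Subgroup.strictWidthInfty_SL2Z] at this
  simpa [fourierCoeff₁] using! this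

theorem fourierCoeff₁_zero (m : ℕ) : fourierCoeff₁ 0 m = 0 := by
  simp [fourierCoeff₁, UpperHalfPlane.qExpansion_zero]

/-- There are no nonzero cusp forms of level one below weight 12. This supplies l ≥ 0, which the
convergence of L(s,h) uses. -/
theorem IsPrimitiveForm.weight_ge {w : ℤ} {f : CuspForm 𝒮ℒ w} (hf : IsPrimitiveForm f) :
    12 ≤ w := by
  by_contra! hw
  have h0 := CuspForm.rank_eq_zero_of_weight_lt_twelve hw
  rw [rank_zero_iff] at h0
  have h1 := hf.normalized
  rw [Subsingleton.elim f 0, FunLike.coe_zero, fourierCoeff₁_zero] at h1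
  exact zero_ne_one h1

/-- The Hecke relation `c(p m) + p^(w-1) c(m/p) = μ c(m)`. -/
theorem HeckeEigen.fourierCoeff_mul {w : ℤ} {f : CuspForm 𝒮ℒ w} {p : ℕ} (hp : p.Prime) {μ : ℂ}
    (hf : HeckeEigen w f p μ) (m : ℕ) :
    fourierCoeff₁ f (p * m) + (if p ∣ m then (p : ℂ) ^ (w - 1) * fourierCoeff₁ f (m / p) else 0)
      = μ * fourierCoeff₁ f m := by
  have hp0 : p ≠ 0 := hp.ne_zero
  have hpC : (p : ℂ) ≠ 0 := by exact_mod_cast hp0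
  have hpR : (0 : ℝ) < p := by exact_mod_cast hp.pos
  have h1 : (1 : ℝ) ∈ (𝒮ℒ : Subgroup (GL (Fin 2) ℝ)).strictPeriods := by simp
  have hcusp : Fact (IsCusp OnePoint.infty (𝒮ℒ : Subgroup (GL (Fin 2) ℝ))) :=
    ⟨Subgroup.isCusp_of_mem_strictPeriods one_pos h1⟩
  have hq (τ : ℍ) : HasSum (fun m : ℕ ↦ fourierCoeff₁ f m *
      Function.Periodic.qParam 1 τ ^ m) (f τ) :=
    ModularForm.hasSum_qExpansion f one_pos h1 τ
  let c := fourierCoeff₁ f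
  have hdil (z : ℍ) : HasSum (fun n : ℕ ↦ (if p ∣ n then c (n / p) else 0) *
      Function.Periodic.qParam 1 z ^ n) (f (UpperHalfPlane.ofComplex ((p : ℂ) * z))) := by
    have him : 0 < ((p : ℂ) * z).im := by simpa using mul_pos hpR z.im_pos
    rw [UpperHalfPlane.ofComplex_apply_of_im_pos him]
    have hinj : Function.Injective fun n : ℕ ↦ p * n := mul_right_injective₀ hp0
    refine (hinj.hasSum_iff ?_).mp ?_
    · intro n hn
      rw [if_neg, zero_mul]
      rintro ⟨t, rfl⟩
      exact hn ⟨t, rfl⟩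
    · convert hq ⟨(p : ℂ) * z, him⟩ using 2 with n
      simp only [Function.comp_apply, dvd_mul_right, if_true, Nat.mul_div_cancel_left _ hp.pos, c]
      rw [pow_mul]
      congr 2
      simp only [Function.Periodic.qParam]
      rw [← Complex.exp_nat_mul]
      congr 1
      ring
  have havg (z : ℍ) : HasSum (fun n : ℕ ↦ c (p * n) * Function.Periodic.qParam 1 z ^ n)
      ((p : ℂ)⁻¹ * ∑ b ∈ Finset.range p, f (UpperHalfPlane.ofComplex (((z : ℂ) + b) / p))) := by
    have him (b : ℕ) : 0 < (((z : ℂ) + b) / p).im := by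
      simpa using div_pos z.im_pos hpR
    simp_rw [fun b ↦ UpperHalfPlane.ofComplex_apply_of_im_pos (him b)]
    have hs := (hasSum_sum fun (b : ℕ) (_ : b ∈ Finset.range p) ↦ hq ⟨_, him b⟩).mul_left (p : ℂ)⁻¹
    let ζ : ℂ := Complex.exp (2 * Real.pi * Complex.I / p)
    have hζ : IsPrimitiveRoot ζ p := Complex.isPrimitiveRoot_exp p hp0
    -- Orthogonality of p-th roots of unity: averaging over the shifts b keeps exactly the exponents
    -- divisible by p.
    have hterm (m : ℕ) : (p : ℂ)⁻¹ * ∑ b ∈ Finset.range p,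
        c m * Function.Periodic.qParam 1 (((z : ℂ) + b) / p) ^ m
        = if p ∣ m then c m * Function.Periodic.qParam 1 ((z : ℂ) / p) ^ m else 0 := by
      have h2 (b : ℕ) : c m * Function.Periodic.qParam 1 (((z : ℂ) + b) / p) ^ m
          = c m * Function.Periodic.qParam 1 ((z : ℂ) / p) ^ m * (ζ ^ m) ^ b := by
        rw [mul_assoc]
        congr 1
        simp only [Function.Periodic.qParam, ζ]
        rw [← Complex.exp_nat_mul, ← Complex.exp_nat_mul, ← Complex.exp_nat_mul,
          ← Complex.exp_nat_mul, ← Complex.exp_add]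
        congr 1
        push_cast
        field_simp
      simp_rw [h2]
      rw [← Finset.mul_sum]
      split_ifs with hpm
      · rw [(hζ.pow_eq_one_iff_dvd m).mpr hpm]
        simp only [one_pow, Finset.sum_const, Finset.card_range, nsmul_eq_mul, mul_one]
        field_simp
      · have hne : ζ ^ m - 1 ≠ 0 := fun h0 ↦ hpm ((hζ.pow_eq_one_iff_dvd m).mp (sub_eq_zero.mp h0))
        have hgeom := geom_sum_mul (ζ ^ m) p
        rw [← pow_mul, mul_comm m, pow_mul, hζ.pow_eq_one, one_pow, sub_self] at hgeom
        rw [(mul_eq_zero.mp hgeom).resolve_right hne, mul_zero, mul_zero]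
    have hs' : HasSum (fun m : ℕ ↦ if p ∣ m then
        c m * Function.Periodic.qParam 1 ((z : ℂ) / p) ^ m else 0) _ :=
      hs.congr_fun fun m ↦ (hterm m).symm
    have hinj : Function.Injective fun n : ℕ ↦ p * n := mul_right_injective₀ hp0
    rw [← hinj.hasSum_iff] at hs'
    · convert hs' using 2 with n
      simp only [Function.comp_apply, dvd_mul_right, if_true]
      rw [pow_mul]
      congr 2
      simp only [Function.Periodic.qParam]
      rw [← Complex.exp_nat_mul]
      congr 1
      field_simp
    · intro n hn
      rw [if_neg]
      rintro ⟨t, rfl⟩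
      exact hn ⟨t, rfl⟩
  -- Two q-expansions of μ • f, one by scaling and one through the Hecke operator, are compared
  -- coefficientwise.
  have e1 := ModularFormClass.qExpansion_coeff_unique one_pos h1 (f := μ • f)
    (c := fun n ↦ μ * c n) (fun τ ↦ by
      simpa [mul_assoc] using! (hq τ).mul_left μ) m
  have e2 := ModularFormClass.qExpansion_coeff_unique one_pos h1 (f := μ • f)
    (c := fun n ↦ (p : ℂ) ^ (w - 1) * (if p ∣ n then c (n / p) else 0) + c (p * n)) (fun τ ↦ by
      have := ((hdil τ).mul_left ((p : ℂ) ^ (w - 1))).add (havg τ)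
      have h3 := hf τ
      rw [heckeOperator] at h3
      rw [h3] at this
      simpa [add_mul, mul_assoc] using! this) m
  have e3 := e2.trans e1.symm
  simp only [c, mul_ite, mul_zero] at e3
  rw [add_comm]
  exact e3

/-! ### The Kronecker symbol -/

theorem kroneckerPrime_trichotomy (a : ℤ) (p : ℕ) :
    kroneckerPrime a p = 0 ∨ kroneckerPrime a p = 1 ∨ kroneckerPrime a p = -1 := by
  rw [kroneckerPrime]
  split_ifs
  · exact ZMod.isQuadratic_χ₈ _
  · exact jacobiSym.trichotomy a p

/-- Evaluates the symbol in T(p²) at the index |d| r²: the factor (r/p)² is 1 or 0. -/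
theorem kroneckerPrime_mul_sq (a : ℤ) {p : ℕ} (hp : p.Prime) (r : ℕ) :
    kroneckerPrime (a * (r : ℤ) ^ 2) p = if p ∣ r then 0 else kroneckerPrime a p := by
  have := Fact.mk hp
  rw [kroneckerPrime, kroneckerPrime]
  by_cases h2 : p = 2
  · subst h2
    simp only [if_true]
    push_cast
    rw [map_mul, map_pow]
    split_ifs with h
    · have : ZMod.χ₈ (r : ZMod 8) = 0 := by
        rw [ZMod.χ₈_nat_eq_if_mod_eight, if_pos (by omega)]
      simp [this]
    · have : ZMod.χ₈ (r : ZMod 8) ^ 2 = 1 := by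
        rw [ZMod.χ₈_nat_eq_if_mod_eight, if_neg (by omega)]
        split_ifs <;> norm_num
      rw [this, mul_one]
  · simp only [h2, if_false]
    rw [jacobiSym.mul_left, jacobiSym.pow_left]
    split_ifs with h
    · have : jacobiSym (r : ℤ) p = 0 := by
        rw [jacobiSym.eq_zero_iff]
        refine ⟨hp.ne_zero, ?_⟩
        rw [Int.gcd_natCast_natCast, Nat.gcd_eq_right h]
        exact hp.one_lt.ne'
      simp [this]
    · have hc : Int.gcd (r : ℤ) p = 1 := by
        rw [Int.gcd_natCast_natCast]
        exact ((hp.coprime_iff_not_dvd).mpr h).symm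
      rw [jacobiSym.sq_one hc, mul_one]

theorem kroneckerSymbol_one_right (D : ℤ) : kroneckerSymbol D 1 = 1 := by
  simp [kroneckerSymbol]

theorem kroneckerSymbol_prime_mul (D : ℤ) {p : ℕ} (hp : p.Prime) {m : ℕ} (hm : m ≠ 0) :
    kroneckerSymbol D (p * m) = kroneckerPrime D p * kroneckerSymbol D m := by
  rw [kroneckerSymbol, kroneckerSymbol, if_neg (mul_ne_zero hp.ne_zero hm), if_neg hm,
    ((Nat.perm_primeFactorsList_mul hp.ne_zero hm).map _).prod_eq, Nat.primeFactorsList_prime hp]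
  simp

theorem norm_kroneckerSymbol_le (D : ℤ) (m : ℕ) : ‖(kroneckerSymbol D m : ℂ)‖ ≤ 1 := by
  rcases eq_or_ne m 0 with rfl | hm
  · rw [kroneckerSymbol, if_pos rfl]
    split_ifs <;> simp
  induction m using Nat.recOnMul with
  | zero => exact absurd rfl hm
  | one => simp [kroneckerSymbol_one_right]
  | prime p hp =>
    have := kroneckerSymbol_prime_mul D hp one_ne_zero
    rw [kroneckerSymbol_one_right, mul_one, mul_one] at this
    rw [this]
    rcases kroneckerPrime_trichotomy D p with h | h | h <;> simp [h]
  | mul a b iha ihb =>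
    have ha : a ≠ 0 := left_ne_zero_of_mul hm
    have hb : b ≠ 0 := right_ne_zero_of_mul hm
    have : kroneckerSymbol D (a * b) = kroneckerSymbol D a * kroneckerSymbol D b := by
      rw [kroneckerSymbol, kroneckerSymbol, kroneckerSymbol, if_neg hm, if_neg ha, if_neg hb,
        ((Nat.perm_primeFactorsList_mul ha hb).map _).prod_eq]
      simp
    rw [this, Int.cast_mul, norm_mul]
    exact mul_le_one₀ (iha ha) (norm_nonneg _) (ihb hb)

theorem lseriesSummable_kroneckerSymbol (D : ℤ) {w : ℂ} (hw : 1 < w.re) :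
    LSeriesSummable (fun m ↦ (kroneckerSymbol D m : ℂ)) w :=
  LSeriesSummable_of_bounded_of_one_lt_re (fun m _ ↦ norm_kroneckerSymbol_le D m) hw

/-- Termwise comparison with ζ(2), the n = 1 term being removed on both sides. -/
theorem norm_kroneckerL_sub_one_le (D : ℤ) {w : ℂ} (hw : 2 ≤ w.re) :
    ‖kroneckerL D w - 1‖ ≤ Real.pi ^ 2 / 6 - 1 := by
  have h1 := (lseriesSummable_kroneckerSymbol D (by linarith : 1 < w.re)).LSeriesHasSum
  have h2 := HasSum.sub h1 (hasSum_ite_eq (1 : ℕ) (1 : ℂ))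
  have h3 := hasSum_zeta_two.sub (hasSum_ite_eq (1 : ℕ) (1 : ℝ))
  refine h2.norm_le_of_bounded h3 fun n ↦ ?_
  rcases eq_or_ne n 0 with rfl | hn
  · simp
  split_ifs with hn1
  · subst hn1
    simp [LSeries.term_of_ne_zero, kroneckerSymbol_one_right]
  · rw [sub_zero, sub_zero, LSeries.norm_term_eq, if_neg hn]
    have hn0 : (1 : ℝ) ≤ n := by exact_mod_cast Nat.one_le_iff_ne_zero.mpr hn
    refine div_le_div₀ zero_le_one (norm_kroneckerSymbol_le D n) (by positivity) ?_
    rw [← Real.rpow_natCast]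
    exact Real.rpow_le_rpow_of_exponent_le hn0 (by exact_mod_cast hw)

/-- Since 2 - π²/6 > 1/4. Uniformity in D gives not only nonvanishing but also convergence of the
sum over discriminants. -/
theorem one_fourth_le_norm_kroneckerL (D : ℤ) {w : ℂ} (hw : 2 ≤ w.re) :
    1 / 4 ≤ ‖kroneckerL D w‖ := by
  have h1 := norm_kroneckerL_sub_one_le D hw
  have h2 : ‖(1 : ℂ)‖ ≤ ‖kroneckerL D w‖ + ‖kroneckerL D w - 1‖ := by
    have := norm_sub_le (kroneckerL D w) (kroneckerL D w - 1)
    simpa using this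
  rw [norm_one] at h2
  have := Real.pi_lt_d2
  nlinarith [Real.pi_pos]

/-! ### Dirichlet convolution and Hecke relations -/

/-- Factorizations pm = d·e are split according to p ∣ e: here p is cancelled from e, and in the
companion lemma, where p ∤ e, from d. -/
theorem sum_divisorsAntidiagonal_prime_mul_of_dvd {M : Type*} [AddCommMonoid M] {p : ℕ} (hp : p ≠ 0)
    (m : ℕ) (F : ℕ → ℕ → M) :
    ∑ x ∈ (p * m).divisorsAntidiagonal with p ∣ x.2, F x.1 x.2
      = ∑ x ∈ m.divisorsAntidiagonal, F x.1 (p * x.2) := by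
  symm
  refine Finset.sum_bij (fun x _ ↦ (x.1, p * x.2)) ?_ ?_ ?_ ?_
  · rintro ⟨d, e⟩ hx
    simp only [Finset.mem_filter, Nat.mem_divisorsAntidiagonal, dvd_mul_right, and_true] at hx ⊢
    exact ⟨by rw [← hx.1]; ring, mul_ne_zero hp hx.2⟩
  · rintro ⟨d, e⟩ _ ⟨d', e'⟩ _ h
    simpa [hp] using h
  · rintro ⟨d, e⟩ hx
    simp only [Finset.mem_filter, Nat.mem_divisorsAntidiagonal] at hx
    obtain ⟨⟨h1, h2⟩, t, rfl⟩ := hx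
    refine ⟨(d, t), ?_, rfl⟩
    simp only [Nat.mem_divisorsAntidiagonal]
    refine ⟨mul_left_cancel₀ hp ?_, right_ne_zero_of_mul h2⟩
    rw [← h1]; ring
  · simp

theorem sum_divisorsAntidiagonal_prime_mul_of_not_dvd {M : Type*} [AddCommMonoid M] {p : ℕ}
    (hp : p.Prime) (m : ℕ) (F : ℕ → ℕ → M) :
    ∑ x ∈ (p * m).divisorsAntidiagonal with ¬ p ∣ x.2, F x.1 x.2
      = ∑ x ∈ m.divisorsAntidiagonal with ¬ p ∣ x.2, F (p * x.1) x.2 := by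
  symm
  refine Finset.sum_bij (fun x _ ↦ (p * x.1, x.2)) ?_ ?_ ?_ ?_
  · rintro ⟨d, e⟩ hx
    simp only [Finset.mem_filter, Nat.mem_divisorsAntidiagonal] at hx ⊢
    exact ⟨⟨by rw [← hx.1.1]; ring, mul_ne_zero hp.ne_zero hx.1.2⟩, hx.2⟩
  · rintro ⟨d, e⟩ _ ⟨d', e'⟩ _ h
    simpa [hp.ne_zero] using h
  · rintro ⟨d, e⟩ hx
    simp only [Finset.mem_filter, Nat.mem_divisorsAntidiagonal] at hx
    obtain ⟨⟨h1, h2⟩, h3⟩ := hx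
    obtain ⟨t, rfl⟩ : p ∣ d := (hp.dvd_mul.mp (h1 ▸ dvd_mul_right p m)).resolve_right h3
    refine ⟨(t, e), ?_, rfl⟩
    simp only [Finset.mem_filter, Nat.mem_divisorsAntidiagonal]
    refine ⟨⟨mul_left_cancel₀ hp.ne_zero ?_, right_ne_zero_of_mul h2⟩, h3⟩
    rw [← h1]; ring
  · simp

/-- Arithmetic functions with the same Hecke recursion at all primes are proportional. -/
theorem eq_mul_of_hecke_recursion {b c β μ : ℕ → ℂ} (hc1 : c 1 = 1)
    (hb : ∀ p, p.Prime → ∀ m ≠ 0,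
      b (p * m) + (if p ∣ m then β p * b (m / p) else 0) = μ p * b m)
    (hc : ∀ p, p.Prime → ∀ m ≠ 0,
      c (p * m) + (if p ∣ m then β p * c (m / p) else 0) = μ p * c m) :
    ∀ m ≠ 0, b m = b 1 * c m := by
  intro m
  induction m using Nat.strong_induction_on with
  | _ m ih =>
    intro hm
    rcases eq_or_ne m 1 with rfl | hm1
    · rw [hc1, mul_one]
    obtain ⟨p, hp, t, rfl⟩ := Nat.exists_prime_and_dvd hm1
    have ht : t ≠ 0 := right_ne_zero_of_mul hm
    have hlt : t < p * t := lt_mul_of_one_lt_left (Nat.pos_of_ne_zero ht) hp.one_lt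
    have h1 := hb p hp t ht
    have h2 := hc p hp t ht
    rw [ih t hlt ht] at h1
    split_ifs at h1 h2 with hd
    · rw [ih (t / p) ((Nat.div_le_self t p).trans_lt hlt) (Nat.div_pos (Nat.le_of_dvd
        (Nat.pos_of_ne_zero ht) hd) hp.pos).ne'] at h1
      linear_combination h1 - b 1 * h2
    · linear_combination h1 - b 1 * h2

/-- If `a` satisfies the Hecke recursion twisted by the completely multiplicative function `χ`,
then `χ ⍟ a` satisfies the untwisted one. -/
theorem convolution_hecke_recursion {a χ β μ : ℕ → ℂ}
    (hχ : ∀ p, p.Prime → ∀ m ≠ 0, χ (p * m) = χ p * χ m)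
    (ha : ∀ p, p.Prime → ∀ m ≠ 0, a (p * m) + χ p * (if p ∣ m then 0 else a m)
      + (if p ∣ m then β p * a (m / p) else 0) = μ p * a m)
    {p : ℕ} (hp : p.Prime) {m : ℕ} (hm : m ≠ 0) :
    LSeries.convolution χ a (p * m)
      + (if p ∣ m then β p * LSeries.convolution χ a (m / p) else 0)
      = μ p * LSeries.convolution χ a m := by
  simp only [LSeries.convolution_def]
  have hR : μ p * ∑ x ∈ m.divisorsAntidiagonal, χ x.1 * a x.2
      = (∑ x ∈ m.divisorsAntidiagonal, χ x.1 * a (p * x.2)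
        + ∑ x ∈ m.divisorsAntidiagonal, χ x.1 * (χ p * (if p ∣ x.2 then 0 else a x.2)))
        + ∑ x ∈ m.divisorsAntidiagonal, χ x.1 * (if p ∣ x.2 then β p * a (x.2 / p) else 0) := by
    rw [← Finset.sum_add_distrib, ← Finset.sum_add_distrib, Finset.mul_sum]
    refine Finset.sum_congr rfl fun x hx ↦ ?_
    rw [Nat.mem_divisorsAntidiagonal] at hx
    have := ha p hp x.2 (right_ne_zero_of_mul (hx.1 ▸ hx.2))
    linear_combination -χ x.1 * this
  rw [hR]
  congr 1
  -- The first two sums are the parts p ∣ e and p ∤ e of the convolution at pm; the twisted term of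
  -- the recursion provides exactly the second.
  · rw [← Finset.sum_filter_add_sum_filter_not (p * m).divisorsAntidiagonal (fun x ↦ p ∣ x.2),
      sum_divisorsAntidiagonal_prime_mul_of_dvd hp.ne_zero m (fun d e ↦ χ d * a e),
      sum_divisorsAntidiagonal_prime_mul_of_not_dvd hp m (fun d e ↦ χ d * a e)]
    congr 1
    rw [Finset.sum_filter]
    refine Finset.sum_congr rfl fun x hx ↦ ?_
    rw [Nat.mem_divisorsAntidiagonal] at hx
    rw [hχ p hp x.1 (left_ne_zero_of_mul (hx.1 ▸ hx.2))]
    split_ifs <;> first | contradiction | ring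
  · simp only [mul_ite, mul_zero]
    rw [← Finset.sum_filter]
    split_ifs with hd
    · obtain ⟨t, rfl⟩ := hd
      rw [sum_divisorsAntidiagonal_prime_mul_of_dvd hp.ne_zero t
        (fun d e ↦ χ d * (β p * a (e / p))), Nat.mul_div_cancel_left _ hp.pos, Finset.mul_sum]
      refine Finset.sum_congr rfl fun x _ ↦ ?_
      rw [Nat.mul_div_cancel_left _ hp.pos]
      ring
    · rw [Finset.sum_eq_zero]
      intro x hx
      rw [Finset.mem_filter, Nat.mem_divisorsAntidiagonal] at hx
      exact absurd (hx.1.1 ▸ hx.2.mul_left x.1) hd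

/-! ### Fundamental discriminants -/

/-- The p-adic valuations of A and B lie in {0, 1} and have the same parity. -/
theorem Nat.eq_of_squarefree_mul_sq {A B x y : ℕ} (hA : Squarefree A) (hB : Squarefree B)
    (hx : x ≠ 0) (hy : y ≠ 0) (h : A * x ^ 2 = B * y ^ 2) : A = B := by
  refine Nat.eq_of_factorization_eq hA.ne_zero hB.ne_zero fun p ↦ ?_
  have h1 := congrArg (fun n ↦ n.factorization p) h
  simp only [Nat.factorization_mul hA.ne_zero (pow_ne_zero 2 hx),
    Nat.factorization_mul hB.ne_zero (pow_ne_zero 2 hy), Nat.factorization_pow, Finsupp.add_apply,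
    Finsupp.smul_apply, smul_eq_mul] at h1
  have h2 := hA.natFactorization_le_one p
  have h3 := hB.natFactorization_le_one p
  omega

theorem IsFundamentalDiscriminant.emod_four {d : ℤ} (hd : IsFundamentalDiscriminant d) :
    d % 4 = 0 ∨ d % 4 = 1 := by
  rcases hd with ⟨h, -⟩ | ⟨m, rfl, -⟩ <;> omega

/-- The squarefree part A fixes t through its class mod 4, hence fixes d; uniqueness of d reduces to
uniqueness of A. -/
theorem IsFundamentalDiscriminant.exists_squarefree {d : ℤ} (hd : IsFundamentalDiscriminant d) :
    ∃ (A : ℤ) (t : ℕ), d = A * (t : ℤ) ^ 2 ∧ Squarefree A ∧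
      (A % 4 = 1 ∧ t = 1 ∨ (A % 4 = 2 ∨ A % 4 = 3) ∧ t = 2) := by
  rcases hd with ⟨h, h'⟩ | ⟨m, rfl, h, h'⟩
  · exact ⟨d, 1, by simp, h', .inl ⟨h, rfl⟩⟩
  · exact ⟨m, 2, by push_cast; ring, h', .inr ⟨h, rfl⟩⟩

theorem IsFundamentalDiscriminant.eq_of_mul_sq_eq {d d' : ℤ} (hd : IsFundamentalDiscriminant d)
    (hd' : IsFundamentalDiscriminant d') {r r' : ℕ} (hr : r ≠ 0) (hr' : r' ≠ 0)
    (h : d * (r : ℤ) ^ 2 = d' * (r' : ℤ) ^ 2) : d = d' ∧ r = r' := by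
  obtain ⟨A, t, rfl, hA, ht⟩ := hd.exists_squarefree
  obtain ⟨A', t', rfl, hA', ht'⟩ := hd'.exists_squarefree
  have ht0 : t ≠ 0 := by omega
  have ht0' : t' ≠ 0 := by omega
  have h1 : A * ((t * r : ℕ) : ℤ) ^ 2 = A' * ((t' * r' : ℕ) : ℤ) ^ 2 := by
    push_cast; linarith
  have h2 : A.natAbs = A'.natAbs := by
    refine Nat.eq_of_squarefree_mul_sq (Int.squarefree_natAbs.mpr hA)
      (Int.squarefree_natAbs.mpr hA') (mul_ne_zero ht0 hr) (mul_ne_zero ht0' hr') ?_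
    have := congrArg Int.natAbs h1
    simpa [Int.natAbs_mul, Int.natAbs_pow] using this
  have hAA : A = A' := by
    rcases Int.natAbs_eq_natAbs_iff.mp h2 with h3 | h3
    · exact h3
    · exfalso
      have p1 : (0 : ℤ) < ((t * r : ℕ) : ℤ) ^ 2 := by positivity
      have p2 : (0 : ℤ) < ((t' * r' : ℕ) : ℤ) ^ 2 := by positivity
      rw [h3] at h1
      have : A' * (((t * r : ℕ) : ℤ) ^ 2 + ((t' * r' : ℕ) : ℤ) ^ 2) = 0 := by linarith
      rcases mul_eq_zero.mp this with h4 | h4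
      · exact hA'.ne_zero h4
      · omega
  subst hAA
  have htt : t = t' := by omega
  subst htt
  refine ⟨rfl, ?_⟩
  have h5 := mul_left_cancel₀ (mul_ne_zero hA.ne_zero (by positivity)) h
  have h6 : r ^ 2 = r' ^ 2 := by exact_mod_cast h5
  exact Nat.pow_left_injective two_ne_zero h6

theorem exists_fundamentalDiscriminant_mul_sq {D : ℤ} (hD : D ≠ 0) (h4 : D % 4 = 0 ∨ D % 4 = 1) :
    ∃ (d : ℤ) (r : ℕ), IsFundamentalDiscriminant d ∧ r ≠ 0 ∧ D = d * (r : ℤ) ^ 2 := by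
  obtain ⟨a, b, hab, ha⟩ := Nat.sq_mul_squarefree D.natAbs
  obtain ⟨A, hA, hDA⟩ : ∃ A : ℤ, Squarefree A ∧ D = A * (b : ℤ) ^ 2 := by
    rcases Int.natAbs_eq D with h | h
    · exact ⟨a, Int.squarefree_natCast.mpr ha, by rw [h, ← hab]; push_cast; ring⟩
    · exact ⟨-a, by rw [← Int.squarefree_natAbs]; simpa using ha,
        by rw [h, ← hab]; push_cast; ring⟩
  have hb : b ≠ 0 := by
    rintro rfl
    simp [hDA] at hD
  have hA4 : A % 4 ≠ 0 := by
    intro h0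
    have := hA 2 (by omega)
    rw [Int.isUnit_iff] at this
    omega
  by_cases h1 : A % 4 = 1
  · exact ⟨A, b, .inl ⟨h1, hA⟩, hb, hDA⟩
  · have h23 : A % 4 = 2 ∨ A % 4 = 3 := by omega
    -- If b were odd, then b² ≡ 1 mod 4 and D ≡ A ≡ 2, 3 mod 4. So b is even and a factor 4 of b²
    -- moves into the discriminant.
    have hbe : 2 ∣ b := by
      by_contra hbo
      obtain ⟨t, rfl⟩ : ∃ t, b = 2 * t + 1 := ⟨b / 2, by omega⟩
      have : D = 4 * (A * (t ^ 2 + t)) + A := by rw [hDA]; push_cast; ring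
      omega
    obtain ⟨r, rfl⟩ := hbe
    refine ⟨4 * A, r, .inr ⟨A, rfl, h23, hA⟩, right_ne_zero_of_mul hb, ?_⟩
    rw [hDA]; push_cast; ring

theorem Int.negOnePow_coe_eq (l : ℤ) : (l.negOnePow : ℤ) = 1 ∨ (l.negOnePow : ℤ) = -1 := by
  rcases Int.units_eq_one_or l.negOnePow with h | h <;> simp [h]

theorem negOnePow_mul_natAbs {l d : ℤ} (hd : 0 < (l.negOnePow : ℤ) * d) :
    (l.negOnePow : ℤ) * (d.natAbs : ℤ) = d := by
  rcases Int.negOnePow_coe_eq l with h | h <;> rw [h] at hd ⊢ <;> omega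

theorem negOnePow_mul_natAbs_mul_sq {l d : ℤ} (hd : 0 < (l.negOnePow : ℤ) * d) (r : ℕ) :
    (l.negOnePow : ℤ) * ((d.natAbs * r ^ 2 : ℕ) : ℤ) = d * (r : ℤ) ^ 2 := by
  push_cast
  rw [← Int.natCast_natAbs, ← mul_assoc, negOnePow_mul_natAbs hd]

theorem Int.sq_emod_four (r : ℤ) : r ^ 2 % 4 = 0 ∨ r ^ 2 % 4 = 1 := by
  rcases Int.even_or_odd' r with ⟨t, rfl | rfl⟩
  · left
    have : (2 * t) ^ 2 = 4 * t ^ 2 := by ring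
    omega
  · right
    have : (2 * t + 1) ^ 2 = 4 * (t ^ 2 + t) + 1 := by ring
    omega

theorem IsFundamentalDiscriminant.isPlusIndex {l d : ℤ} (hd : IsFundamentalDiscriminant d)
    (hpos : 0 < (l.negOnePow : ℤ) * d) (r : ℕ) : IsPlusIndex l (d.natAbs * r ^ 2) := by
  rw [IsPlusIndex, negOnePow_mul_natAbs_mul_sq hpos]
  rcases hd.emod_four with h | h <;> rcases Int.sq_emod_four r with h' | h' <;>
    rw [Int.mul_emod, h, h'] <;> simp

/-- For `p ∤ m`, the quotient `|d| m² / p²` is not a plus index. -/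
theorem IsFundamentalDiscriminant.not_isPlusIndex_div {l d : ℤ} (hd : IsFundamentalDiscriminant d)
    (hpos : 0 < (l.negOnePow : ℤ) * d) {p : ℕ} (hp : p.Prime) {m : ℕ} (hm : ¬ p ∣ m)
    (hdvd : p ^ 2 ∣ d.natAbs * m ^ 2) : ¬ IsPlusIndex l (d.natAbs * m ^ 2 / p ^ 2) := by
  have hpd : p ^ 2 ∣ d.natAbs :=
    (((hp.coprime_iff_not_dvd.mpr hm).pow 2 2).dvd_mul_right).mp hdvd
  have hpd' : (p : ℤ) * p ∣ d := by
    rw [← sq]; exact_mod_cast Int.natCast_dvd.mpr hpd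
  have hpu : ¬ IsUnit (p : ℤ) := by
    rw [Int.isUnit_iff]
    have := hp.two_le
    omega
  rcases hd with ⟨-, hsq⟩ | ⟨m₀, rfl, hm₀, hsq⟩
  · exact absurd (hsq _ hpd') hpu
  -- An odd p would have p² ∣ m₀. For p = 2 the quotient carries m₀ m² with m odd, which is ≡ m₀ ≡
  -- 2, 3 mod 4.
  · have hp2 : p = 2 := by
      by_contra hne
      have hc : Nat.Coprime (p ^ 2) 4 := by
        have h2 : Nat.Coprime p 2 := (Nat.coprime_primes hp Nat.prime_two).mpr hne
        simpa using h2.pow 2 2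
      rw [Int.natAbs_mul] at hpd
      have h1 : p ^ 2 ∣ m₀.natAbs := hc.dvd_of_dvd_mul_left hpd
      have h2 : (p : ℤ) * p ∣ m₀ := by
        rw [← sq]; exact_mod_cast Int.natCast_dvd.mpr h1
      exact hpu (hsq _ h2)
    subst hp2
    have e : (4 * m₀).natAbs * m ^ 2 / 2 ^ 2 = m₀.natAbs * m ^ 2 := by
      rw [Int.natAbs_mul, mul_assoc]
      exact Nat.mul_div_cancel_left _ (by norm_num)
    have hpos' : 0 < (l.negOnePow : ℤ) * m₀ := by
      rcases Int.negOnePow_coe_eq l with h | h <;> rw [h] at hpos ⊢ <;> omega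
    rw [e, IsPlusIndex, negOnePow_mul_natAbs_mul_sq hpos']
    obtain ⟨t, rfl⟩ : ∃ t, m = 2 * t + 1 := ⟨m / 2, by omega⟩
    have : m₀ * ((2 * t + 1 : ℕ) : ℤ) ^ 2 = 4 * (m₀ * (t ^ 2 + t)) + m₀ := by push_cast; ring
    omega

/-! ### Hecke recursions along |d| m². -/

/-- The recursion for `m ↦ c(|d| m²)` expressing that `h` is an eigenform of `T(p²)`. -/
theorem KohnenHeckeEigen.recursion {l : ℤ} {h : ℍ → ℂ}
    (hplus : ∀ m : ℕ, ¬ IsPlusIndex l m → fourierCoeff₁ h m = 0) {p : ℕ} (hp : p.Prime) {μ : ℂ}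
    (hμ : KohnenHeckeEigen l h p μ) {d : ℤ} (hd : IsFundamentalDiscriminant d)
    (hpos : 0 < (l.negOnePow : ℤ) * d) {m : ℕ} :
    fourierCoeff₁ h (d.natAbs * (p * m) ^ 2)
      + (kroneckerPrime d p : ℂ) * (p : ℂ) ^ (l - 1)
        * (if p ∣ m then 0 else fourierCoeff₁ h (d.natAbs * m ^ 2))
      + (if p ∣ m then (p : ℂ) ^ (2 * l - 1) * fourierCoeff₁ h (d.natAbs * (m / p) ^ 2) else 0)
      = μ * fourierCoeff₁ h (d.natAbs * m ^ 2) := by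
  have h1 := hμ (d.natAbs * m ^ 2)
  rw [kohnenHecke, if_pos (hd.isPlusIndex hpos m), negOnePow_mul_natAbs_mul_sq hpos,
    kroneckerPrime_mul_sq _ hp] at h1
  rw [← h1]
  congr 1
  · congr 1
    · congr 1; ring
    · split_ifs <;> simp
  · by_cases hpm : p ∣ m
    · obtain ⟨t, rfl⟩ := hpm
      have e : d.natAbs * (p * t) ^ 2 = p ^ 2 * (d.natAbs * t ^ 2) := by ring
      rw [if_pos (dvd_mul_right _ _), Nat.mul_div_cancel_left _ hp.pos, e,
        if_pos (dvd_mul_right _ _), Nat.mul_div_cancel_left _ (pow_pos hp.pos 2)]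
    · rw [if_neg hpm]
      -- Even with p ∤ m, p² can divide |d| m² (p = 2, 4 ∣ d); the plus condition kills that
      -- coefficient.
      split_ifs with hdvd
      · rw [hplus _ (hd.not_isPlusIndex_div hpos hp hpm hdvd), mul_zero]
      · rfl

/-- `∑_{d e = m} χ(d) d^(l-1) c_h(|d₀| e²) = c_h(|d₀|) c_f(m)`. -/
theorem IsShimuraLift.convolution_eq {l : ℤ} {h : ℍ → ℂ}
    (hplus : ∀ m : ℕ, ¬ IsPlusIndex l m → fourierCoeff₁ h m = 0) {w : ℤ} (hw : w = 2 * l)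
    {f : CuspForm 𝒮ℒ w}
    (hf1 : fourierCoeff₁ f 1 = 1) (hhf : IsShimuraLift l h f) {d : ℤ}
    (hd : IsFundamentalDiscriminant d) (hpos : 0 < (l.negOnePow : ℤ) * d) {m : ℕ} (hm : m ≠ 0) :
    LSeries.convolution (fun r ↦ (kroneckerSymbol d r : ℂ) * (r : ℂ) ^ (l - 1))
      (fun r ↦ fourierCoeff₁ h (d.natAbs * r ^ 2)) m
      = fourierCoeff₁ h d.natAbs * fourierCoeff₁ f m := by
  subst hw
  have hμ : ∀ p : ℕ, ∃ μ : ℂ, p.Prime →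
      KohnenHeckeEigen l h p μ ∧ HeckeEigen (2 * l) f p μ := fun p ↦ by
    by_cases hp : p.Prime
    · obtain ⟨μ, h⟩ := hhf p hp
      exact ⟨μ, fun _ ↦ h⟩
    · exact ⟨0, fun h ↦ absurd h hp⟩
  choose μ hμ using hμ
  have hsymb (p : ℕ) (hp : p.Prime) : kroneckerSymbol d p = kroneckerPrime d p := by
    simpa [kroneckerSymbol_one_right] using kroneckerSymbol_prime_mul d hp one_ne_zero
  -- The convolution and c_f share both β_p = p^(2l-1) and, by the Shimura correspondence, μ_p; the
  -- constant is the convolution at 1, namely c_h(|d|).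
  have := eq_mul_of_hecke_recursion (c := fourierCoeff₁ f)
    (b := LSeries.convolution (fun r ↦ (kroneckerSymbol d r : ℂ) * (r : ℂ) ^ (l - 1))
      (fun r ↦ fourierCoeff₁ h (d.natAbs * r ^ 2)))
    (β := fun p ↦ (p : ℂ) ^ (2 * l - 1)) (μ := μ) hf1 (fun p hp m hm ↦ ?_)
    (fun p hp m hm ↦ ?_) m hm
  · rw [this]
    congr 1
    simp [LSeries.convolution_def, kroneckerSymbol_one_right]
  · refine convolution_hecke_recursion (β := fun p ↦ (p : ℂ) ^ (2 * l - 1)) ?_ ?_ hp hm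
    · intro p hp m hm
      rw [kroneckerSymbol_prime_mul d hp hm, hsymb p hp]
      push_cast
      rw [mul_zpow]
      ring
    · intro p hp m hm
      rw [hsymb p hp]
      exact (hμ p hp).1.recursion hplus hp hd hpos
  · exact (hμ p hp).2.fourierCoeff_mul hp m

/-! ### Summation over discriminants. -/

theorem LSeries.term_mul_sq (c : ℕ → ℂ) (s : ℂ) {a r : ℕ} (ha : a ≠ 0) (hr : r ≠ 0) :
    LSeries.term c s (a * r ^ 2)
      = (a : ℂ) ^ (-s) * LSeries.term (fun r ↦ c (a * r ^ 2)) (2 * s) r := by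
  have hr' : (r : ℂ) ≠ 0 := by exact_mod_cast hr
  have e : ((a * r ^ 2 : ℕ) : ℂ) ^ s = (a : ℂ) ^ s * ((r : ℂ) ^ s * (r : ℂ) ^ s) := by
    rw [Nat.cast_mul, Complex.natCast_mul_natCast_cpow, sq, Nat.cast_mul,
      Complex.natCast_mul_natCast_cpow]
  rw [LSeries.term_of_ne_zero (mul_ne_zero ha (pow_ne_zero 2 hr)), LSeries.term_of_ne_zero hr, e,
    two_mul, Complex.cpow_add _ _ hr', Complex.cpow_neg]
  field_simp

theorem LSeries.term_mul_zpow (c : ℕ → ℂ) (j : ℤ) (s : ℂ) (n : ℕ) :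
    LSeries.term (fun r ↦ c r * (r : ℂ) ^ j) s n = LSeries.term c (s - j) n := by
  rcases eq_or_ne n 0 with rfl | hn
  · simp
  have hn' : (n : ℂ) ≠ 0 := by exact_mod_cast hn
  rw [LSeries.term_of_ne_zero hn, LSeries.term_of_ne_zero hn, Complex.cpow_sub _ _ hn',
    Complex.cpow_intCast]
  field_simp

/-- The factorization of the Dirichlet series of an eigenform in the Kohnen plus space. -/
theorem IsShimuraLift.lseries_eq {l : ℤ} {h : ℍ → ℂ}
    (hplus : ∀ m : ℕ, ¬ IsPlusIndex l m → fourierCoeff₁ h m = 0) {w : ℤ} (hw : w = 2 * l)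
    {f : CuspForm 𝒮ℒ w} (hf1 : fourierCoeff₁ f 1 = 1) (hhf : IsShimuraLift l h f) {s : ℂ}
    (hs : LSeriesSummable (fourierCoeff₁ h) s) (hs2 : 2 ≤ (2 * s - l + 1).re) :
    Summable (fun d : {d : ℤ // IsFundamentalDiscriminant d ∧ 0 < (l.negOnePow : ℤ) * d} ↦
      fourierCoeff₁ h (d : ℤ).natAbs * ((d : ℤ).natAbs : ℂ) ^ (-s) *
        (kroneckerL d (2 * s - l + 1))⁻¹) ∧
    LSeries (fourierCoeff₁ h) s = LSeries (fourierCoeff₁ f) (2 * s) *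
      ∑' d : {d : ℤ // IsFundamentalDiscriminant d ∧ 0 < (l.negOnePow : ℤ) * d},
        fourierCoeff₁ h (d : ℤ).natAbs * ((d : ℤ).natAbs : ℂ) ^ (-s) *
          (kroneckerL d (2 * s - l + 1))⁻¹ := by
  let D := {d : ℤ // IsFundamentalDiscriminant d ∧ 0 < (l.negOnePow : ℤ) * d}
  -- r = 0 must be excluded: it would send every d to 0 and destroy injectivity of φ.
  let S : Set ℕ := {r | r ≠ 0}
  let φ : D × S → ℕ := fun x ↦ (x.1 : ℤ).natAbs * (x.2 : ℕ) ^ 2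
  have hD0 (d : D) : (d : ℤ).natAbs ≠ 0 := by
    have := d.2.2
    rw [Int.natAbs_ne_zero]
    rintro h0
    simp [h0] at this
  have hφ : Function.Injective φ := by
    rintro ⟨d, r⟩ ⟨d', r'⟩ hx
    have h1 := congrArg (fun n : ℕ ↦ (l.negOnePow : ℤ) * (n : ℤ)) hx
    simp only [φ] at h1
    rw [negOnePow_mul_natAbs_mul_sq d.2.2, negOnePow_mul_natAbs_mul_sq d'.2.2] at h1
    obtain ⟨h2, h3⟩ := d.2.1.eq_of_mul_sq_eq d'.2.1 r.2 r'.2 h1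
    exact Prod.ext (Subtype.ext h2) (Subtype.ext h3)
  have hrange : ∀ m ∉ Set.range φ, LSeries.term (fourierCoeff₁ h) s m = 0 := by
    intro m hm
    rcases eq_or_ne m 0 with rfl | hm0
    · simp
    rw [LSeries.term_of_ne_zero hm0, hplus m, zero_div]
    intro hpl
    apply hm
    have hne : (l.negOnePow : ℤ) * (m : ℤ) ≠ 0 := by simpa using hm0
    obtain ⟨d, r, hd, hr, hmd⟩ := exists_fundamentalDiscriminant_mul_sq hne hpl
    have hr2 : (0 : ℤ) < (r : ℤ) ^ 2 := by positivity
    have hm0' : (0 : ℤ) < m := by positivity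
    have hεε : (l.negOnePow : ℤ) * (l.negOnePow : ℤ) = 1 := by
      rcases Int.negOnePow_coe_eq l with h | h <;> simp [h]
    have hm1 : (m : ℤ) = (l.negOnePow : ℤ) * d * (r : ℤ) ^ 2 := by
      rw [mul_assoc, ← hmd, ← mul_assoc, hεε, one_mul]
    have hpos : 0 < (l.negOnePow : ℤ) * d := by
      rw [hm1] at hm0'
      exact pos_of_mul_pos_left hm0' hr2.le
    refine ⟨⟨⟨d, hd, hpos⟩, ⟨r, hr⟩⟩, ?_⟩
    have := negOnePow_mul_natAbs_mul_sq hpos r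
    rw [← hmd] at this
    have h3 := mul_left_cancel₀ (a := (l.negOnePow : ℤ)) (by simp) this
    exact_mod_cast h3
  have hsum : Summable (fun x : D × S ↦ LSeries.term (fourierCoeff₁ h) s (φ x)) :=
    hs.comp_injective hφ
  have hterm (d : D) (r : S) : LSeries.term (fourierCoeff₁ h) s (φ (d, r))
      = ((d : ℤ).natAbs : ℂ) ^ (-s) *
        LSeries.term (fun r ↦ fourierCoeff₁ h ((d : ℤ).natAbs * r ^ 2)) (2 * s) r :=
    LSeries.term_mul_sq _ s (hD0 d) r.2
  have hne (d : D) : ((d : ℤ).natAbs : ℂ) ^ (-s) ≠ 0 := by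
    rw [Ne, Complex.cpow_eq_zero_iff]
    rintro ⟨h0, -⟩
    exact hD0 d (by exact_mod_cast h0)
  have hsupp (c : ℕ → ℂ) : Function.support (LSeries.term c (2 * s)) ⊆ S := by
    intro r hr h0
    exact hr (by rw [show r = 0 from h0, LSeries.term_zero])
  have hsumd (d : D) :
      LSeriesSummable (fun r ↦ fourierCoeff₁ h ((d : ℤ).natAbs * r ^ 2)) (2 * s) := by
    have h1 := hsum.prod_factor d
    simp_rw [hterm] at h1
    rw [summable_mul_left_iff (hne d)] at h1
    have h2 := (summable_subtype_iff_indicator (s := S) (f := LSeries.term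
      (fun r ↦ fourierCoeff₁ h ((d : ℤ).natAbs * r ^ 2)) (2 * s))).mp h1
    rwa [Set.indicator_eq_self.mpr (hsupp _)] at h2
  have hL0 (d : ℤ) : kroneckerL d (2 * s - l + 1) ≠ 0 := by
    have := one_fourth_le_norm_kroneckerL d hs2
    rw [← norm_pos_iff]
    linarith
  have hL (d : D) : LSeries (fun r ↦ fourierCoeff₁ h ((d : ℤ).natAbs * r ^ 2)) (2 * s)
      = LSeries (fourierCoeff₁ f) (2 * s) *
        (fourierCoeff₁ h (d : ℤ).natAbs * (kroneckerL d (2 * s - l + 1))⁻¹) := by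
    have hsub : 2 * s - ((l - 1 : ℤ) : ℂ) = 2 * s - l + 1 := by push_cast; ring
    have hχ : LSeries (fun r ↦ (kroneckerSymbol d r : ℂ) * (r : ℂ) ^ (l - 1)) (2 * s)
        = kroneckerL d (2 * s - l + 1) := by
      rw [kroneckerL, ← hsub, LSeries, LSeries]
      exact tsum_congr fun n ↦ LSeries.term_mul_zpow _ _ _ n
    have hχs : LSeriesSummable (fun r ↦ (kroneckerSymbol d r : ℂ) * (r : ℂ) ^ (l - 1)) (2 * s) := by
      have := lseriesSummable_kroneckerSymbol d (w := 2 * s - l + 1) (by linarith)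
      rw [← hsub] at this
      exact this.congr fun n ↦ (LSeries.term_mul_zpow _ _ _ n).symm
    have h1 := LSeries_convolution' hχs (hsumd d)
    rw [hχ, LSeries_congr (g := fourierCoeff₁ h (d : ℤ).natAbs • fourierCoeff₁ f)
      (fun hn ↦ by simpa using hhf.convolution_eq hplus hw hf1 d.2.1 d.2.2 hn), LSeries_smul] at h1
    have := hL0 d
    field_simp
    linear_combination -h1
  constructor
  -- The terms with r = 1 form a subfamily of the absolutely convergent series L(s,h); the inverse
  -- L-values cost a factor of at most 4.
  · have h1 : Summable fun d : D ↦ LSeries.term (fourierCoeff₁ h) s (φ (d, ⟨1, one_ne_zero⟩)) :=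
      hsum.comp_injective (i := fun d : D ↦ (d, (⟨1, one_ne_zero⟩ : S))) fun a b hab ↦
        (Prod.ext_iff.mp hab).1
    refine Summable.of_norm_bounded (h1.norm.mul_right 4) fun d ↦ ?_
    rw [hterm, norm_mul _ (kroneckerL _ _)⁻¹]
    have h2 : ‖(kroneckerL d (2 * s - l + 1))⁻¹‖ ≤ 4 := by
      rw [norm_inv]
      have h3 := one_fourth_le_norm_kroneckerL d hs2
      exact (inv_anti₀ (by norm_num) h3).trans_eq (by norm_num)
    refine mul_le_mul (le_of_eq ?_) h2 (norm_nonneg _) (norm_nonneg _)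
    rw [LSeries.term_of_ne_zero one_ne_zero, mul_comm]
    simp
  · calc LSeries (fourierCoeff₁ h) s
        = ∑' x : D × S, LSeries.term (fourierCoeff₁ h) s (φ x) :=
          (hφ.tsum_eq fun m hm ↦ by_contra fun h0 ↦ hm (hrange m h0)).symm
      _ = ∑' d : D, ∑' r : S, LSeries.term (fourierCoeff₁ h) s (φ (d, r)) := hsum.tsum_prod
      _ = ∑' d : D, LSeries (fourierCoeff₁ f) (2 * s) * (fourierCoeff₁ h (d : ℤ).natAbs *
            ((d : ℤ).natAbs : ℂ) ^ (-s) * (kroneckerL d (2 * s - l + 1))⁻¹) := by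
          refine tsum_congr fun d ↦ ?_
          simp_rw [hterm]
          rw [tsum_mul_left, tsum_subtype_eq_of_support_subset (hsupp _)]
          change _ * LSeries _ _ = _
          rw [hL d]
          ring
      _ = _ := tsum_mul_left

end

theorem proposition4p4p4 (k n : ℕ) (hk : Even k) (hk0 : 0 < k) (hn : Even n) (hn0 : 0 < n)
    (h : ℍ → ℂ) (hh : IsKohnenPlusEigenform ((k : ℤ) - (n : ℤ) / 2) h)
    (f : CuspForm 𝒮ℒ (2 * (k : ℤ) - (n : ℤ))) (hf : IsPrimitiveForm f)
    (hhf : IsShimuraLift ((k : ℤ) - (n : ℤ) / 2) h f)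
    (s : ℂ) (hs : ((k : ℝ) - (n : ℝ) / 2) / 2 + 3 / 4 < s.re) :
    LSeriesSummable (fourierCoeff₁ h) s ∧
    LSeriesSummable (fourierCoeff₁ f) (2 * s) ∧
    (∀ d₀ : ℤ, IsFundamentalDiscriminant d₀ → 0 < (-1 : ℤ) ^ (n / 2) * d₀ →
      LSeriesSummable (fun m ↦ (kroneckerSymbol d₀ m : ℂ)) (2 * s - k + n / 2 + 1) ∧
      kroneckerL d₀ (2 * s - k + n / 2 + 1) ≠ 0) ∧
    Summable (fun d₀ : {d : ℤ // IsFundamentalDiscriminant d ∧ 0 < (-1 : ℤ) ^ (n / 2) * d} ↦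
      fourierCoeff₁ h (d₀ : ℤ).natAbs * ((d₀ : ℤ).natAbs : ℂ) ^ (-s) *
        (kroneckerL d₀ (2 * s - k + n / 2 + 1))⁻¹) ∧
    LSeries (fourierCoeff₁ h) s =
      LSeries (fourierCoeff₁ f) (2 * s) *
        ∑' d₀ : {d : ℤ // IsFundamentalDiscriminant d ∧ 0 < (-1 : ℤ) ^ (n / 2) * d},
          fourierCoeff₁ h (d₀ : ℤ).natAbs * ((d₀ : ℤ).natAbs : ℂ) ^ (-s) *
            (kroneckerL d₀ (2 * s - k + n / 2 + 1))⁻¹ := by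
  obtain ⟨j, rfl⟩ := hn
  have hj : (j + j) / 2 = j := by omega
  have hl : (k : ℤ) - ((j + j : ℕ) : ℤ) / 2 = (k : ℤ) - j := by push_cast; omega
  rw [hl] at hh hhf
  have hw : 2 * (k : ℤ) - ((j + j : ℕ) : ℤ) = 2 * ((k : ℤ) - j) := by push_cast; ring
  have hl6 : 6 ≤ (k : ℤ) - j := by
    have := hf.weight_ge
    omega
  have hlR : (6 : ℝ) ≤ (k : ℝ) - j := by exact_mod_cast hl6
  -- k is even, so (-1)^(k-j) = (-1)^j.
  have hε : (((k : ℤ) - j).negOnePow : ℤ) = (-1) ^ ((j + j) / 2) := by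
    rw [hj, Int.negOnePow_sub, Int.negOnePow_even _ (by exact_mod_cast hk), one_mul,
      Int.coe_negOnePow_natCast]
  have hs' : ((k : ℝ) - j) / 2 + 3 / 4 < s.re := by
    have e : (((j + j : ℕ) : ℝ)) / 2 = j := by push_cast; ring
    rwa [e] at hs
  have harg : 2 * s - (k : ℂ) + ((j + j : ℕ) : ℂ) / 2 + 1
      = 2 * s - (((k : ℤ) - j : ℤ) : ℂ) + 1 := by push_cast; ring
  -- Twice the bound on Re s gives Re 2s > l + 3/2, so the real part here exceeds 5/2.
  have hre : 2 ≤ (2 * s - (((k : ℤ) - j : ℤ) : ℂ) + 1).re := by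
    simp
    linarith
  have hsum_h : LSeriesSummable (fourierCoeff₁ h) s :=
    hh.toIsHalfIntegralCuspForm.lseriesSummable (by omega) (by push_cast; exact hs')
  have hmain := hhf.lseries_eq hh.plus hw hf.normalized hsum_h hre
  rw [harg]
  rw [hε] at hmain
  refine ⟨hsum_h, f.lseriesSummable ?_, fun d _ _ ↦ ⟨?_, ?_⟩, hmain⟩
  · rw [hw]
    push_cast
    simp
    linarith
  · exact lseriesSummable_kroneckerSymbol d (by linarith)
  · have := one_fourth_le_norm_kroneckerL d hre
    rw [← norm_pos_iff]
    linarith
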